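/- Throughout, $\varsigma=e^{i\pi/4}$, and all edge lengths are of order $1$. **Domain.** Let $\Omega$ be a finite discrete simply connected domain made of quads of a planar graph $\Lambda(G)=G^\bullet\cup G^\circ$ (quads $z=(v_0^\bullet v_0^\circ v_1^\bullet v_1^\circ)$ correspond to edges of $G^\bullet$; edges $c=(v^\bullet v^\circ)$ of $\Lambda(G)$ are called corners). Its boundary consists of a wired arc through white vertices $v^\circ_0,\dots,v^\circ_n$ with boundary half-quads $z_k=(v^\circ_k v^\bullet_k v^\circ_{k+1})$, of a free arc through black vertices, also made of half-quads, and of two corners at which the arcs meet. Let $\beta J_z>0$ be Ising couplings, $\theta_z=2\arctan e^{-2\beta J_z}$, and let $\mathcal S:\Lambda(G)\to\mathbb C$ be a proper non-degenerate s-embedding: $\mathcal S(v^\bullet(c))-\mathcal S(v^\circ(c))=\mathcal X(c)^2$ for a complex spinor $\mathcal X$ satisfying the three-term relations $\mathcal X(c_{pq})=\mathcal X(c_{p,1-q})\cos\theta_z+\mathcal X(c_{1-p,q})\sin\theta_z$ at neighbouring lifts of the corners $c_{pq}=(v^\bullet_pv^\circ_q)$ of each quad to the double cover of the set of corners branching around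 every $v^\bullet$, $v^\circ$ and $z$. Half-quads are halves of quads of the ambient s-embedding. The origami function $\mathcal Q$ is defined, up to a constant, by $\mathcal Q(v^\bullet)-\mathcal Q(v^\circ)=|\mathcal S(v^\bullet)-\mathcal S(v^\circ)|$ at every corner. **Observable.** For the Ising model on $G^\circ\cap\Omega$, with spins wired along the wired arc and free along the free arc, let $X(c)=\mathbb E[\mu_{v^\bullet(c)}\sigma_{v^\circ(c)}\,\sigma_{\rm wired}\,\mu_{\rm free}]$ be the Kadanoff–Ceva FK observable (with $\mu_{v^\bullet(c)}\mu_{\rm free}=\prod_{e\in\gamma}e^{-2\beta J_e\sigma_{v_0^\circ(e)}\sigma_{v_1^\circ(e)}}$ for a disorder line $\gamma\subset G^\bullet$ from $v^\bullet(c)$ to the free arc; $X$ is a spinor, i.e. it is defined up to sign, $|X(c)|$ being well defined). Let $F$ be the associated s-holomorphic function on quads and half-quads: $X(c)=\mathrm{Re}[\overline\varsigma\,\mathcal X(c)F(z)]$ for each corner $c$ of $z$, and for any two faces $z,z'$ sharing a corner $c$ the projections of $F(z)$ and $F(z')$ onto the line $\eta_c\mathbb R$, $\eta_c=\varsigma\exp[-\tfrac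 i2\arg(\mathcal S(v^\bullet(c))-\mathcal S(v^\circ(c)))]$, coincide. $F$ is defined up to a global sign. **Horizontal layer.** Suppose that $z_k$, $k_0\le k<k_1$, form a horizontal boundary layer of halves of kites at the bottom of the domain: $\mathcal S(v^\circ_{k+1})-\mathcal S(v^\circ_k)>0$ is real, $\mathcal S(v_k^\bullet)$ lies strictly above this line, the fourth vertex of the kite lies strictly below it, and the quads of the domain touching $v^\circ_k$ for $k_0<k<k_1$ lie above the line, with black vertices strictly above it. Suppose also that the layer satisfies $\mathrm{Unif}(1,r_0,\theta_0)$ with $r_0\ge1$, $\theta_0>0$: $r_0^{-1}\le|\mathcal S(v_k^\bullet)-\mathcal S(v^\circ)|\le r_0$ for $v^\circ\in\{v^\circ_k,v^\circ_{k+1}\}$, and angles are at least $\theta_0$ (only the angle of $z_k$ at $v_k^\bullet$ matters). **Claim.** There exist $\phi_0>0$ and $C>0$, depending only on $r_0$ and $\theta_0$, such that, in every such situation and for a suitable choice of the global sign of $F$, for all $k_0\le k<k_1$ and all real $\phi$ with $|\phi|\le\frac\pi4+\phi_0$, $$\mathrm{Re}[F(z_k)e^{i\phi}]\ge0\qquad\text{and}\qquad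 C^{-1}|X(c_k^\pm)|\le\mathrm{Re}\Big[e^{i\phi}\big(F(z_k)\,d\mathcal S+i\,\overline{F(z_k)}\,d\mathcal Q\big)\Big]\le C\,|X(c_k^\pm)|,$$ where $c_k^-=(v_k^\bullet v_k^\circ)$, $c_k^+=(v_k^\bullet v_{k+1}^\circ)$, $d\mathcal S=\mathcal S(v^\circ_{k+1})-\mathcal S(v^\circ_k)$ and $d\mathcal Q=\mathcal Q(v^\circ_{k+1})-\mathcal Q(v^\circ_k)$. -/

import Mathlib

open Complex

/-- Combinatorial data of a discrete domain with Dobrushin boundary conditions.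
`B` is the set of vertices of `G•`, `W` the set of vertices of `G∘` and `Q` the set of (full) quads
of the domain. A quad `z` has black vertices `b z 0`, `b z 1` and white vertices `w z 0`, `w z 1`,
in the cyclic order `b z 0, w z 0, b z 1, w z 1`; it stands for the edge of `G•` joining its black
vertices and for the dual edge joining its white vertices.

Along the wired arc the boundary visits the white vertices `wired 0, …, wired n`, and
`(wired k, apex k, wired (k+1))` is the `k`-th boundary half-quad. Along the free arc the boundary
visits the black vertices `free 0, …, free m`, with boundary half-quads
`(free j, freeApex j, free (j+1))`. The boundary is completed by the two marked corners
`(free 0, wired n)` and `(free m, wired 0)`.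

`K z = β J_z` is the Ising coupling constant carried by the quad `z`. -/
structure DomainData (B W Q : Type) (n m : ℕ) where
  b : Q → Fin 2 → B
  w : Q → Fin 2 → W
  wired : Fin (n + 1) → W
  apex : Fin n → B
  free : Fin (m + 1) → B
  freeApex : Fin m → W
  K : Q → ℝ

/-- The faces of the domain: quads, half-quads of the wired arc, half-quads of the free arc. -/
abbrev Face (Q : Type) (n m : ℕ) : Type := Q ⊕ (Fin n ⊕ Fin m)

/-- The `k`-th boundary half-quad of the wired arc. -/
abbrev wiredFace {Q : Type} {n m : ℕ} (k : Fin n) : Face Q n m := Sum.inr (Sum.inl k)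

/-- The `j`-th boundary half-quad of the free arc. -/
abbrev freeFace {Q : Type} {n m : ℕ} (j : Fin m) : Face Q n m := Sum.inr (Sum.inr j)

/-- Data of an s-embedding of a domain: the positions `S` of the vertices of `Λ(G)`; for each face, the
angle `θ` and the values `X p q` of the spinor `𝒳` at (lifts of) the corners of the quad it is
or belongs to. A boundary half-quad is a half of a quad of the ambient s-embedding: the vertex of
this quad that is not in the domain (a black one along the wired arc, a white one along the free
arc) has position `missing`. -/
structure EmbeddingData (B W Q : Type) (n m : ℕ) where
  S : B ⊕ W → ℂ
  missing : Fin n ⊕ Fin m → ℂ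
  θ : Face Q n m → ℝ
  X : Face Q n m → Fin 2 → Fin 2 → ℂ

namespace EmbeddingData

variable {B W Q : Type} {n m : ℕ}

/-- The position of a black vertex. -/
abbrev black (E : EmbeddingData B W Q n m) (v : B) : ℂ := E.S (Sum.inl v)

/-- The position of a white vertex. -/
abbrev white (E : EmbeddingData B W Q n m) (y : W) : ℂ := E.S (Sum.inr y)

end EmbeddingData

namespace DomainData

variable {B W Q : Type} {n m : ℕ}

/-- `D.HasCorner f v y`: the edge `(v y)` of `Λ(G)`, with `v` black and `y` white, is a side of the
face `f`. -/
def HasCorner (D : DomainData B W Q n m) : Face Q n m → B → W → Prop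
  | Sum.inl z, v, y => (∃ p, D.b z p = v) ∧ (∃ q, D.w z q = y)
  | Sum.inr (Sum.inl k), v, y =>
      D.apex k = v ∧ (D.wired k.castSucc = y ∨ D.wired k.succ = y)
  | Sum.inr (Sum.inr j), v, y =>
      (D.free j.castSucc = v ∨ D.free j.succ = v) ∧ D.freeApex j = y

/-- The two corners at which the wired arc and the free arc meet. -/
def IsMarkedCorner (D : DomainData B W Q n m) (v : B) (y : W) : Prop :=
  (v = D.free 0 ∧ y = D.wired (Fin.last n)) ∨ (v = D.free (Fin.last m) ∧ y = D.wired 0)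

/-- The graph `G•`, with any two vertices of the free arc joined to each other. -/
def blackGraph (D : DomainData B W Q n m) : SimpleGraph B :=
  SimpleGraph.fromRel fun v v' =>
    (∃ z, D.b z 0 = v ∧ D.b z 1 = v') ∨ (v ∈ Set.range D.free ∧ v' ∈ Set.range D.free)

/-- The faces fit together to a discrete simply connected domain (a connected surface with one
boundary curve and Euler characteristic `1`), whose boundary is made of a wired and a free arc;
the model on it is ferromagnetic. -/
structure IsDobrushinDomain [Fintype B] [Fintype W] [Fintype Q] (D : DomainData B W Q n m) :
    Prop where
  K_pos : ∀ z, 0 < D.K z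
  b_ne : ∀ z, D.b z 0 ≠ D.b z 1
  w_ne : ∀ z, D.w z 0 ≠ D.w z 1
  wired_injective : Function.Injective D.wired
  free_injective : Function.Injective D.free
  /-- every corner is a side of exactly two faces, except the two marked boundary corners -/
  glue : ∀ f v y, D.HasCorner f v y → ¬ D.IsMarkedCorner v y →
    {g | D.HasCorner g v y}.ncard = 2
  glue_marked : ∀ v y, D.IsMarkedCorner v y → {g | D.HasCorner g v y}.ncard = 1
  /-- the faces around a vertex form a single fan -/
  white_fan : ∀ y f g, (∃ v, D.HasCorner f v y) → (∃ v, D.HasCorner g v y) →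
    Relation.ReflTransGen (fun f g => ∃ v, D.HasCorner f v y ∧ D.HasCorner g v y) f g
  black_fan : ∀ v f g, (∃ y, D.HasCorner f v y) → (∃ y, D.HasCorner g v y) →
    Relation.ReflTransGen (fun f g => ∃ y, D.HasCorner f v y ∧ D.HasCorner g v y) f g
  white_mem : ∀ y, ∃ f v, D.HasCorner f v y
  connected : D.blackGraph.Connected
  euler : Fintype.card B + Fintype.card W = Fintype.card Q + n + m + 2

noncomputable section

/-! ### The Ising model and its Kadanoff–Ceva fermion -/

/-- The abstract angle `θ_z = 2 arctan x`, with `x = exp(-2βJ)`. -/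
def theta (D : DomainData B W Q n m) (z : Q) : ℝ := 2 * Real.arctan (Real.exp (-2 * D.K z))

/-- A spin in `{±1}` as a real number. -/
def spin (σ : W → ℤˣ) (y : W) : ℝ := ((σ y : ℤ) : ℝ)

open Classical in
/-- Spin configurations on `G∘` with wired boundary conditions on the wired arc; there is no
constraint on the free arc. -/
def configs [Fintype W] (D : DomainData B W Q n m) : Finset (W → ℤˣ) :=
  Finset.univ.filter fun σ => ∀ i, σ (D.wired i) = σ (D.wired 0)

/-- The product of the two spins separated by the edge `z`. -/
def bond (D : DomainData B W Q n m) (z : Q) (σ : W → ℤˣ) : ℝ :=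
  spin σ (D.w z 0) * spin σ (D.w z 1)

/-- The Boltzmann weight of a spin configuration. -/
def weight [Fintype Q] (D : DomainData B W Q n m) (σ : W → ℤˣ) : ℝ :=
  Real.exp (∑ z, D.K z * D.bond z σ)

/-- Expectation in the Ising model with Dobrushin boundary conditions. -/
def expect [Fintype W] [Fintype Q] (D : DomainData B W Q n m) (f : (W → ℤˣ) → ℝ) : ℝ :=
  (∑ σ ∈ D.configs, D.weight σ * f σ) / ∑ σ ∈ D.configs, D.weight σ

/-- `γ` is a disorder line linking the black vertex `v` to the free arc, the free arc being
considered as a single vertex of `G•`. -/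
def IsDisorderLine (D : DomainData B W Q n m) (v : B) (γ : Finset Q) : Prop :=
  ∀ v' : B, v' ∉ Set.range D.free →
    (Odd {z | z ∈ γ ∧ ∃ p, D.b z p = v'}.ncard ↔ v' = v)

/-- The FK observable `X(c) = 𝔼[μ_{v•(c)} σ_{v∘(c)} σ_{wired arc} μ_{free arc}]` at a corner `c`
with white vertex `y`; the disorder `μ_{v•(c)} μ_{free arc}` is realised by the disorder line `γ`
from `v•(c)` to the free arc. Changing `γ` may change the sign: `γ` selects one of the two
lifts of `c` to the double cover. -/
def fkObservable [Fintype W] [Fintype Q] (D : DomainData B W Q n m) (y : W) (γ : Finset Q) : ℝ :=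
  D.expect fun σ =>
    spin σ y * spin σ (D.wired 0) * ∏ z ∈ γ, Real.exp (-2 * D.K z * D.bond z σ)

/-- The values of the FK observable at the four corners `c_{pq} = (b z p, w z q)` of a quad `z`, the
lift of `c_{00}` being given by a disorder line `γ` from `b z 0`. Neighbouring lifts are obtained
by moving the disorder along the edge `z` (`γ` becomes `γ ∆ {z}`) or by moving the spin across this
edge (a change of sign if the disorder line contains `z`), in the order
`c_{01}, c_{00}, c_{10}, c_{11}`. -/
def quadValue [Fintype W] [Fintype Q] [DecidableEq Q] (D : DomainData B W Q n m) (z : Q)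
    (γ : Finset Q) : Fin 2 → Fin 2 → ℝ :=
  let s : ℝ := if z ∈ γ then -1 else 1
  ![![D.fkObservable (D.w z 0) γ, s * D.fkObservable (D.w z 1) γ],
    ![D.fkObservable (D.w z 0) (symmDiff γ {z}),
      -s * D.fkObservable (D.w z 1) (symmDiff γ {z})]]

/-! ### s-embeddings -/

/-- The three-term relations around a quad with abstract angle `θ`, for lifts of its corners taken
in the order `c_{01}, c_{00}, c_{10}, c_{11}`. The double cover branches over the quad, so the
lift `c_{01}` is a neighbour of the other lift of `c_{11}`; hence the two minus signs. -/
def ThreeTerm (θ : ℝ) (X : Fin 2 → Fin 2 → ℂ) : Prop :=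
  X 0 0 = X 0 1 * Real.cos θ + X 1 0 * Real.sin θ ∧
  X 1 0 = X 1 1 * Real.cos θ + X 0 0 * Real.sin θ ∧
  X 0 1 = X 0 0 * Real.cos θ - X 1 1 * Real.sin θ ∧
  X 1 1 = X 1 0 * Real.cos θ - X 0 1 * Real.sin θ

/-- The positions of the two black vertices of the quad that a face is or belongs to. -/
def bpos (D : DomainData B W Q n m) (E : EmbeddingData B W Q n m) : Face Q n m → Fin 2 → ℂ
  | Sum.inl z => fun p => E.black (D.b z p)
  | Sum.inr (Sum.inl k) => ![E.black (D.apex k), E.missing (Sum.inl k)]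
  | Sum.inr (Sum.inr j) => ![E.black (D.free j.castSucc), E.black (D.free j.succ)]

/-- The positions of the two white vertices of the quad that a face is or belongs to. -/
def wpos (D : DomainData B W Q n m) (E : EmbeddingData B W Q n m) : Face Q n m → Fin 2 → ℂ
  | Sum.inl z => fun q => E.white (D.w z q)
  | Sum.inr (Sum.inl k) => ![E.white (D.wired k.castSucc), E.white (D.wired k.succ)]
  | Sum.inr (Sum.inr j) => ![E.white (D.freeApex j), E.missing (Sum.inr j)]

/-- The centre of the circle inscribed in the quad that a face is or belongs to. -/
def center (D : DomainData B W Q n m) (E : EmbeddingData B W Q n m) (f : Face Q n m) : ℂ :=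
  D.bpos E f 0 - E.X f 0 0 * E.X f 0 1 * Real.cos (E.θ f)

/-- The triangle spanned by the centre of a quad and its side `c_{pq}`. -/
def sector (D : DomainData B W Q n m) (E : EmbeddingData B W Q n m) (f : Face Q n m)
    (p q : Fin 2) : Set ℂ :=
  convexHull ℝ {D.center E f, D.bpos E f p, D.wpos E f q}

/-- The closed polygon drawn by a face. A tangential quadrilateral, convex or not, is star-shaped
about the centre of its inscribed circle, hence it is the union of its four sectors; a half-quad
consists of the two sectors at the sides that belong to the domain. -/
def region (D : DomainData B W Q n m) (E : EmbeddingData B W Q n m) : Face Q n m → Set ℂ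
  | Sum.inl z => ⋃ p, ⋃ q, D.sector E (Sum.inl z) p q
  | Sum.inr (Sum.inl k) => ⋃ q, D.sector E (wiredFace k) 0 q
  | Sum.inr (Sum.inr j) => ⋃ p, D.sector E (freeFace j) p 0

/-- `E` is a proper non-degenerate s-embedding of the domain. -/
structure IsSEmbedding (D : DomainData B W Q n m) (E : EmbeddingData B W Q n m) : Prop where
  θ_quad : ∀ z, E.θ (Sum.inl z) = D.theta z
  θ_mem : ∀ f, E.θ f ∈ Set.Ioo 0 (Real.pi / 2)
  sq : ∀ f p q, D.bpos E f p - D.wpos E f q = E.X f p q ^ 2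
  threeTerm : ∀ f, ThreeTerm (E.θ f) (E.X f)
  nondegenerate : ∀ f, (interior (D.region E f)).Nonempty
  proper : ∀ f g, f ≠ g → Disjoint (interior (D.region E f)) (interior (D.region E g))

/-- `𝒬` is the origami function of the s-embedding. -/
def IsOrigami (D : DomainData B W Q n m) (E : EmbeddingData B W Q n m) (𝒬 : B ⊕ W → ℝ) : Prop :=
  ∀ f v y, D.HasCorner f v y → 𝒬 (Sum.inl v) - 𝒬 (Sum.inr y) = ‖E.black v - E.white y‖

/-! ### s-holomorphic functions -/

/-- `ς = exp(iπ/4)`. -/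
def varsigma : ℂ := Complex.exp (Real.pi / 4 * I)

/-- The Dirac spinor `η_c` of the corner `c = (v y)`, up to sign. -/
def eta (E : EmbeddingData B W Q n m) (v : B) (y : W) : ℂ :=
  varsigma * Complex.exp (-(I / 2) * (arg (E.black v - E.white y) : ℂ))

/-- `Proj[F(f); η_c ℝ] = Proj[F(g); η_c ℝ]` for any two faces sharing the corner `c`. -/
def IsSHolomorphic (D : DomainData B W Q n m) (E : EmbeddingData B W Q n m)
    (F : Face Q n m → ℂ) : Prop :=
  ∀ f g v y, D.HasCorner f v y → D.HasCorner g v y →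
    (Submodule.span ℝ {eta E v y}).starProjection (F f) =
      (Submodule.span ℝ {eta E v y}).starProjection (F g)

/-- The spinor `Re[ς̄ 𝒳(c_{pq}) F(f)]` defined by `F` at the corners of a face. -/
def spinorOf (E : EmbeddingData B W Q n m) (F : Face Q n m → ℂ) (f : Face Q n m)
    (p q : Fin 2) : ℝ :=
  (starRingEnd ℂ varsigma * E.X f p q * F f).re

/-- `F` is an s-holomorphic function associated with the FK observable `X` of the domain: on each
face, `X(c) = Re[ς̄ 𝒳(c) F]` at the corners `c` of the face, where `X` and `𝒳` are evaluated at
compatible lifts of these corners (there are two such choices, whence the sign `s`). In a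
half-quad, neighbouring lifts of its two corners are given by the same disorder line, as no edge
carrying an interaction is crossed. -/
structure IsFKFunction [Fintype W] [Fintype Q] [DecidableEq Q] (D : DomainData B W Q n m)
    (E : EmbeddingData B W Q n m) (F : Face Q n m → ℂ) : Prop where
  sHolomorphic : D.IsSHolomorphic E F
  quad : ∀ z γ, D.IsDisorderLine (D.b z 0) γ → ∃ s : ℝ, (s = 1 ∨ s = -1) ∧
    ∀ p q, D.quadValue z γ p q = s * spinorOf E F (Sum.inl z) p q
  wiredHalf : ∀ k γ, D.IsDisorderLine (D.apex k) γ → ∃ s : ℝ, (s = 1 ∨ s = -1) ∧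
    D.fkObservable (D.wired k.castSucc) γ = s * spinorOf E F (wiredFace k) 0 0 ∧
    D.fkObservable (D.wired k.succ) γ = s * spinorOf E F (wiredFace k) 0 1
  freeHalf : ∀ j γ, D.IsDisorderLine (D.free j.castSucc) γ → ∃ s : ℝ, (s = 1 ∨ s = -1) ∧
    D.fkObservable (D.freeApex j) γ = s * spinorOf E F (freeFace j) 0 0 ∧
    D.fkObservable (D.freeApex j) γ = s * spinorOf E F (freeFace j) 1 0

/-! ### Horizontal layers of kites -/

/-- The half-quads `k₀ ≤ k < k₁` of the wired arc form a horizontal layer at the bottom of the domain,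
traversed from left to right: their white vertices lie on a horizontal line, this line separates
the two black vertices of the quad to which a half-quad belongs (as it does for a kite with a
horizontal diagonal), and the other quads touching the layer between its two ends lie above the
line, with black vertices strictly above it. -/
structure IsHorizontalLayer (D : DomainData B W Q n m) (E : EmbeddingData B W Q n m)
    (k₀ k₁ : ℕ) : Prop where
  re_lt : ∀ k : Fin n, k₀ ≤ k → k < k₁ →
    (E.white (D.wired k.castSucc)).re < (E.white (D.wired k.succ)).re
  im_eq : ∀ k : Fin n, k₀ ≤ k → k < k₁ →
    (E.white (D.wired k.succ)).im = (E.white (D.wired k.castSucc)).im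
  im_apex : ∀ k : Fin n, k₀ ≤ k → k < k₁ →
    (E.white (D.wired k.castSucc)).im < (E.black (D.apex k)).im
  im_missing : ∀ k : Fin n, k₀ ≤ k → k < k₁ →
    (E.missing (Sum.inl k)).im < (E.white (D.wired k.castSucc)).im
  above : ∀ i : Fin (n + 1), k₀ < i → i < k₁ → ∀ f v, D.HasCorner f v (D.wired i) →
    (E.white (D.wired i)).im < (E.black v).im ∧
    ∀ q, (E.white (D.wired i)).im ≤ (D.wpos E f q).im

/-- The assumption `Unif(1, r₀, θ₀)` for the `k`-th half-quad of the wired arc: its sides have lengths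
in `[r₀⁻¹, r₀]` and its angle at the black vertex, which is also the angle there of the quad to
which it belongs, is at least `θ₀`. (The other lengths and angles of the quad are not used.) -/
structure UnifHalfQuad (D : DomainData B W Q n m) (E : EmbeddingData B W Q n m) (r₀ θ₀ : ℝ)
    (k : Fin n) : Prop where
  left_ge : r₀⁻¹ ≤ ‖E.black (D.apex k) - E.white (D.wired k.castSucc)‖
  left_le : ‖E.black (D.apex k) - E.white (D.wired k.castSucc)‖ ≤ r₀
  right_ge : r₀⁻¹ ≤ ‖E.black (D.apex k) - E.white (D.wired k.succ)‖
  right_le : ‖E.black (D.apex k) - E.white (D.wired k.succ)‖ ≤ r₀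
  angle_ge : θ₀ ≤ EuclideanGeometry.angle (E.white (D.wired k.castSucc))
    (E.black (D.apex k)) (E.white (D.wired k.succ))

/-- The boundary increment `F(z_k) dS + i conj(F(z_k)) d𝒬` along the `k`-th half-quad of the wired
arc, from `wired k` to `wired (k+1)`. -/
def increment (D : DomainData B W Q n m) (E : EmbeddingData B W Q n m) (𝒬 : B ⊕ W → ℝ)
    (F : Face Q n m → ℂ) (k : Fin n) : ℂ :=
  F (wiredFace k) * (E.white (D.wired k.succ) - E.white (D.wired k.castSucc)) +
    I * starRingEnd ℂ (F (wiredFace k)) *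
      ((𝒬 (Sum.inr (D.wired k.succ)) - 𝒬 (Sum.inr (D.wired k.castSucc)) : ℝ) : ℂ)

end

end DomainData

/-! Since the wired spins agree, the observable takes one positive value, for a given disorder line,
at both corners of a boundary half-quad. Let `p`, `q` be the first-quadrant square roots of the two
sides issued from the apex, and `G = ς̄F`. Up to sign, `Re[pG] = Re[qG] = x > 0`. The white vertices
being at one height, `p₁p₂ = q₁q₂`, and solving gives `G = t(p₂ - i q₁)` with `t > 0` and `x = t
p₂(p₁ + q₁)` (`linear_form_of_eq`).

As `d𝒮 = p² - q²`, `d𝒬 = |p|² - |q|²` and `iς̄ = ς`, the increment equals `2xς((p₁ - q₁) - i(q₂ -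
p₂))`. With `ω = φ + π/4`, the two real parts to estimate are `t(p₂ cos ω + q₁ sin ω)` and `2x((p₁ -
q₁) cos ω + (q₂ - p₂) sin ω)`. All coefficients are positive, and in each form they are comparable
by `half_quad_ratio_bounds`, so `ω` may leave the first quadrant by a uniform amount
(`mul_cos_add_mul_sin_ge`, `re_increment_bounds`).

It remains to choose one sign for the whole layer (`exists_sign_layer`). The quantity followed is
the coordinate of `F` along `η_c`. Within a face above the line, the three-term relation places the
values of `𝒳` at the two corners of a layer vertex in one quadrant, after matching lifts, and the
observable is positive there; hence the coordinates have the same sign. By s-holomorphicity this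
sign passes to the next face of the fan around the vertex, and through each half-quad it passes from
one vertex to the next. -/

/-! ### Elementary inequalities and square roots in the first quadrant. -/

/-- A lower bound for `u cos ω + v sin ω` for angles `ω` slightly beyond the first quadrant. -/
theorem mul_cos_add_mul_sin_ge {u v m φ₀ ω : ℝ} (hu : 0 < u) (hv : 0 < v) (hm : 0 < m)
    (huv : m * v ≤ u) (hvu : m * u ≤ v) (hφ : 0 ≤ φ₀) (hφm : φ₀ ≤ m / 8)
    (h₁ : -φ₀ ≤ ω) (h₂ : ω ≤ Real.pi / 2 + φ₀) :
    m * (u + v) / 4 ≤ u * Real.cos ω + v * Real.sin ω := by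
  have hm1 : m ≤ 1 := by nlinarith
  have key : ∀ x : ℝ, -φ₀ ≤ x → x ≤ Real.pi / 2 + φ₀ → -φ₀ ≤ Real.sin x := by
    intro x hx hx'
    rcases le_or_gt 0 x with h | h
    · have hs : 0 ≤ Real.sin x :=
        Real.sin_nonneg_of_nonneg_of_le_pi h (by linarith [Real.pi_gt_three])
      linarith
    · have := Real.sin_lt (x := -x) (by linarith)
      rw [Real.sin_neg] at this
      linarith
  have hs := key ω h₁ h₂
  have hc : -φ₀ ≤ Real.cos ω := by
    rw [← Real.sin_pi_div_two_sub]
    exact key _ (by linarith) (by linarith)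
  set c := Real.cos ω
  set s := Real.sin ω
  have hsq : s ^ 2 + c ^ 2 = 1 := Real.sin_sq_add_cos_sq ω
  have habs : 1 ≤ |s| + |c| := by
    nlinarith [abs_nonneg s, abs_nonneg c, sq_abs s, sq_abs c]
  have hs' : |s| ≤ s + 2 * φ₀ := abs_le.2 ⟨by linarith, by linarith⟩
  have hc' : |c| ≤ c + 2 * φ₀ := abs_le.2 ⟨by linarith, by linarith⟩
  -- The shifted values `c + φ₀`, `s + φ₀` are nonnegative with sum at least `1 - 2φ₀`, so both
  -- coefficients may be replaced by their lower bound `m(u + v)/2`. The shift costs at most `2φ₀(u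
  -- + v)` in total, which `φ₀ ≤ m/8` keeps below half of the main term.
  have hμu : m * (u + v) / 2 ≤ u := by nlinarith
  have hμv : m * (u + v) / 2 ≤ v := by nlinarith
  have e1 : m * (u + v) / 2 * (c + φ₀) ≤ u * (c + φ₀) :=
    mul_le_mul_of_nonneg_right hμu (by linarith)
  have e2 : m * (u + v) / 2 * (s + φ₀) ≤ v * (s + φ₀) :=
    mul_le_mul_of_nonneg_right hμv (by linarith)
  have e3 : m * (u + v) / 2 * (1 - 2 * φ₀) ≤ m * (u + v) / 2 * ((c + φ₀) + (s + φ₀)) :=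
    mul_le_mul_of_nonneg_left (by linarith) (by positivity)
  have e4 : φ₀ * (u + v) ≤ m / 8 * (u + v) := mul_le_mul_of_nonneg_right hφm (by positivity)
  have e5 : m * (φ₀ * (u + v)) ≤ 1 * (φ₀ * (u + v)) :=
    mul_le_mul_of_nonneg_right hm1 (by positivity)
  nlinarith

/-- Two points of the first quadrant whose squares lie on the same horizontal line, and a linear
form taking the same value at both. -/
theorem linear_form_of_eq {p₁ p₂ q₁ q₂ g₁ g₂ x : ℝ} (hp₁ : 0 < p₁) (hp₂ : 0 < p₂) (hq₁ : 0 < q₁)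
    (hq₂ : 0 < q₂) (hh : p₁ * p₂ = q₁ * q₂) (hL : q₁ ^ 2 - q₂ ^ 2 < p₁ ^ 2 - p₂ ^ 2)
    (hx : 0 < x) (hp : g₁ * p₁ + g₂ * p₂ = x) (hq : g₁ * q₁ + g₂ * q₂ = x) :
    q₁ < p₁ ∧ p₂ < q₂ ∧ ∃ t, 0 < t ∧ g₁ = t * p₂ ∧ g₂ = t * q₁ ∧ x = t * (p₂ * (p₁ + q₁)) := by
  have h1 : q₁ < p₁ := by
    by_contra! h
    have : q₂ ≤ p₂ := by
      by_contra! h'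
      nlinarith
    nlinarith
  have h2 : p₂ < q₂ := by
    by_contra! h
    nlinarith
  -- Subtracting the two equations and using `p₁p₂ = q₁q₂` shows that `(g₁, g₂)` is proportional to
  -- `(p₂, q₁)`.
  have h3 : g₁ * q₁ = g₂ * p₂ := by
    have : (g₁ * q₁ - g₂ * p₂) * (p₁ - q₁) = 0 := by linear_combination q₁ * hp - q₁ * hq - g₂ * hh
    rcases mul_eq_zero.1 this with h | h <;> linarith
  have hg : g₂ = g₁ / p₂ * q₁ := by field_simp; linarith
  have hg₁ : g₁ = g₁ / p₂ * p₂ := by field_simp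
  have hx' : x = g₁ / p₂ * (p₂ * (p₁ + q₁)) := by
    rw [← hp]; field_simp; linarith
  refine ⟨h1, h2, g₁ / p₂, ?_, hg₁, hg, hx'⟩
  rw [hx'] at hx
  exact (pos_iff_pos_of_mul_pos hx).2 (by positivity)

/-- A square root of a point of the upper half-plane is the principal one up to the sign of its
real part. -/
theorem sqrt_eq_of_sq_im_pos {X d : ℂ} (h : d = X ^ 2) (hd : 0 < d.im) :
    ∃ σ : ℝ, (σ = 1 ∨ σ = -1) ∧ 0 < σ * X.re ∧ 0 < σ * X.im ∧
      σ * X = ‖X‖ * exp (I / 2 * (arg d : ℂ)) := by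
  have him : d.im = 2 * (X.re * X.im) := by rw [h, sq, mul_im]; ring
  have hprod : 0 < X.re * X.im := by linarith
  have hX : 0 < ‖X‖ := norm_pos_iff.2 (by rintro rfl; simp at hprod)
  set e := exp (I / 2 * (arg d : ℂ)) with he
  have he2 : e ^ 2 = exp (arg d * I) := by
    rw [he, ← Complex.exp_nat_mul]; congr 1; push_cast; ring
  have hsq : (‖X‖ * e) ^ 2 = X ^ 2 := by
    rw [mul_pow, he2, ← h]
    have hn : (‖X‖ : ℂ) ^ 2 = ‖d‖ := by rw [h, norm_pow, ofReal_pow]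
    rw [hn, Complex.norm_mul_exp_arg_mul_I]
  -- The value `arg d = π` is excluded by `0 < d.im`, so half the argument lies strictly between
  -- `-π/2` and `π/2`.
  have here : 0 < e.re := by
    have : e = exp (((arg d / 2 : ℝ) : ℂ) * I) := by rw [he]; congr 1; push_cast; ring
    rw [this, exp_ofReal_mul_I_re]
    have h1 := Complex.neg_pi_lt_arg d
    have h2 : arg d < Real.pi := by
      refine lt_of_le_of_ne (Complex.arg_le_pi d) fun h' => ?_
      have := (Complex.arg_eq_pi_iff.1 h').2
      linarith
    exact Real.cos_pos_of_mem_Ioo ⟨by linarith, by linarith⟩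
  have hre : 0 < ((‖X‖ : ℂ) * e).re := by
    rw [re_ofReal_mul]; positivity
  have fin : ∀ σ : ℝ, (σ = 1 ∨ σ = -1) → (σ : ℂ) * X = ‖X‖ * e →
      ∃ σ : ℝ, (σ = 1 ∨ σ = -1) ∧ 0 < σ * X.re ∧ 0 < σ * X.im ∧ σ * X = ‖X‖ * e := by
    intro σ hσ h
    rw [← h, re_ofReal_mul] at hre
    refine ⟨σ, hσ, hre, ?_, h⟩
    rcases hσ with rfl | rfl <;> nlinarith
  rcases sq_eq_sq_iff_eq_or_eq_neg.1 hsq with h | h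
  · exact fin 1 (Or.inl rfl) (by simp [h])
  · exact fin (-1) (Or.inr rfl) (by simp [h])

/-! ### Corner values: coordinates of `F` along the Dirac spinor. -/

namespace DomainData

variable {B W Q : Type} {n m : ℕ}

/-- The coordinate of the projection of `F f` onto the line spanned by `η_c`, `c = (v y)`. -/
noncomputable def cornerValue (E : EmbeddingData B W Q n m) (F : Face Q n m → ℂ) (f : Face Q n m)
    (v : B) (y : W) : ℝ :=
  (starRingEnd ℂ (eta E v y) * F f).re

theorem conj_eta (E : EmbeddingData B W Q n m) (v : B) (y : W) :
    starRingEnd ℂ (eta E v y) =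
      starRingEnd ℂ varsigma * exp (I / 2 * (arg (E.black v - E.white y) : ℂ)) := by
  rw [eta, map_mul, ← Complex.exp_conj]
  congr 2
  simp only [map_mul, map_neg, map_div₀, conj_I, conj_ofReal, Complex.conj_ofNat]
  ring

theorem norm_eta (E : EmbeddingData B W Q n m) (v : B) (y : W) : ‖eta E v y‖ = 1 := by
  rw [eta, varsigma, norm_mul, Complex.norm_exp, Complex.norm_exp]
  simp

/-- Since `η_c` has norm one, the projection onto its line is the corner value times `η_c`. This is
the form in which s-holomorphicity is used. -/
theorem IsSHolomorphic.cornerValue_eq {D : DomainData B W Q n m} {E : EmbeddingData B W Q n m}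
    {F : Face Q n m → ℂ} (h : D.IsSHolomorphic E F) {f g : Face Q n m} {v : B} {y : W}
    (hf : D.HasCorner f v y) (hg : D.HasCorner g v y) :
    cornerValue E F f v y = cornerValue E F g v y := by
  have key := h f g v y hf hg
  have hne : eta E v y ≠ 0 := norm_ne_zero_iff.1 (by rw [norm_eta]; exact one_ne_zero)
  rw [Submodule.starProjection_singleton, Submodule.starProjection_singleton] at key
  have := smul_left_injective ℝ hne key
  simpa [norm_eta, Complex.inner, cornerValue, mul_comm] using this

/-- At a corner pointing upwards, the spinor and the corner value agree up to the sign of `𝒳`. -/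
theorem exists_sign_spinorOf {E : EmbeddingData B W Q n m} (F : Face Q n m → ℂ) {f : Face Q n m}
    {p q : Fin 2} {v : B} {y : W} (h : E.black v - E.white y = E.X f p q ^ 2)
    (him : (E.white y).im < (E.black v).im) :
    ∃ σ : ℝ, (σ = 1 ∨ σ = -1) ∧ 0 < σ * (E.X f p q).re ∧ 0 < σ * (E.X f p q).im ∧
      0 < ‖E.X f p q‖ ∧ σ * spinorOf E F f p q = ‖E.X f p q‖ * cornerValue E F f v y := by
  obtain ⟨σ, hσ, hre, him', hX⟩ := sqrt_eq_of_sq_im_pos h (by rw [sub_im]; linarith)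
  refine ⟨σ, hσ, hre, him', norm_pos_iff.2 ?_, ?_⟩
  · intro h0
    simp [h0] at hre
  · rw [spinorOf, cornerValue, conj_eta, ← re_ofReal_mul, ← re_ofReal_mul]
    congr 1
    linear_combination (starRingEnd ℂ varsigma * F f) * hX

/-- The sign in `exists_sign_spinorOf` is the same at two corners whose spinor values lie in the
same quadrant. -/
theorem sign_eq_of_im_mul_pos {σ τ : ℝ} {X Y : ℂ} (hσ : σ = 1 ∨ σ = -1) (hτ : τ = 1 ∨ τ = -1)
    (h₁ : 0 < σ * X.re) (h₂ : 0 < σ * X.im) (h₃ : 0 < τ * Y.re) (h₄ : 0 < τ * Y.im)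
    (h : 0 < (X * Y).im) : σ = τ := by
  rw [mul_im] at h
  rcases hσ with rfl | rfl <;> rcases hτ with rfl | rfl <;> first | rfl | nlinarith

theorem sign_eq_neg_of_im_mul_neg {σ τ : ℝ} {X Y : ℂ} (hσ : σ = 1 ∨ σ = -1)
    (hτ : τ = 1 ∨ τ = -1) (h₁ : 0 < σ * X.re) (h₂ : 0 < σ * X.im) (h₃ : 0 < τ * Y.re)
    (h₄ : 0 < τ * Y.im) (h : (X * Y).im < 0) : σ = -τ := by
  rw [mul_im] at h
  rcases hσ with rfl | rfl <;> rcases hτ with rfl | rfl <;> nlinarith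

/-! ### Geometry of a single quad -/

theorem im_sq_sub_mul (X Y : ℂ) (t : ℝ) :
    ((X - Y * t) ^ 2).im = (X ^ 2).im - 2 * t * (X * Y).im + t ^ 2 * (Y ^ 2).im := by
  simp only [sq, mul_im, sub_im, sub_re, mul_re, ofReal_re, ofReal_im]; ring

/-- Squaring `X - sY = cZ` gives `2s Im(XY) = Im X² + s² Im Y² - c² Im Z²`, and the last term is at
most `c² Im X²` with `c² < 1`. For `X`, `Y` with squares in the upper half-plane, the sign of
`Im(XY)` tells whether they lie in the same or in opposite quadrants. -/
theorem im_mul_pos_of_upper {c s : ℝ} {X Y Z : ℂ} (hs : 0 < s) (hcs : s ^ 2 + c ^ 2 = 1)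
    (hX : 0 < (X ^ 2).im) (hY : 0 < (Y ^ 2).im) (h : X = Z * c + Y * s)
    (hZ : (Z ^ 2).im ≤ (X ^ 2).im) : 0 < (X * Y).im := by
  have e : (X - Y * s) ^ 2 = ((c ^ 2 : ℝ) : ℂ) * Z ^ 2 := by
    rw [h]; push_cast; ring
  have := im_sq_sub_mul X Y s
  rw [e, im_ofReal_mul] at this
  have h2 : c ^ 2 * (Z ^ 2).im ≤ c ^ 2 * (X ^ 2).im := mul_le_mul_of_nonneg_left hZ (sq_nonneg c)
  have h3 : 0 < s ^ 2 * (X ^ 2).im := by positivity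
  have h4 : 0 < s ^ 2 * (Y ^ 2).im := by positivity
  have : 0 < 2 * s * (X * Y).im := by nlinarith
  exact (pos_iff_pos_of_mul_pos this).1 (by positivity)

/-- Same expansion with the roles of `c` and `s` exchanged; now `Im Z² < 0` only helps. It serves
for the half-quads of the layer, whose missing vertex is below the line. -/
theorem im_mul_pos_of_lower {c s : ℝ} {X Y Z : ℂ} (hc : 0 < c)
    (hX : 0 < (X ^ 2).im) (hY : 0 < (Y ^ 2).im) (h : X = Y * c + Z * s)
    (hZ : (Z ^ 2).im < 0) : 0 < (X * Y).im := by
  have e : (X - Y * c) ^ 2 = ((s ^ 2 : ℝ) : ℂ) * Z ^ 2 := by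
    rw [h]; push_cast; ring
  have := im_sq_sub_mul X Y c
  rw [e, im_ofReal_mul] at this
  have h2 : s ^ 2 * (Z ^ 2).im ≤ 0 := mul_nonpos_of_nonneg_of_nonpos (sq_nonneg s) hZ.le
  have h4 : 0 < c ^ 2 * (Y ^ 2).im := by positivity
  have : 0 < 2 * c * (X * Y).im := by nlinarith
  exact (pos_iff_pos_of_mul_pos this).1 (by positivity)

/-! ### The Ising model -/

theorem odd_card_symmDiff_singleton {α : Type*} [DecidableEq α] (s : Finset α) (z : α) :
    Odd (symmDiff s {z}).card ↔ ¬ Odd s.card := by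
  by_cases hz : z ∈ s
  · have e : symmDiff s {z} = s.erase z := by
      ext x
      by_cases hx : x = z <;> simp [Finset.mem_symmDiff, hx, hz]
    rw [e, ← Finset.card_erase_add_one hz, Nat.odd_add_one, not_not]
  · have e : symmDiff s {z} = insert z s := by
      ext x
      by_cases hx : x = z <;> simp [Finset.mem_symmDiff, hx, hz]
    rw [e, Finset.card_insert_of_notMem hz, Nat.odd_add_one]

/-- Adding the edge `z` to a disorder line moves its end from one endpoint of `z` to the other. -/
theorem IsDisorderLine.symmDiff_singleton [DecidableEq Q] {D : DomainData B W Q n m} {z : Q}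
    {γ : Finset Q} {v v' : B} (hγ : D.IsDisorderLine v γ) (hne : v ≠ v')
    (hz : ∀ x, (∃ p, D.b z p = x) ↔ x = v ∨ x = v') :
    D.IsDisorderLine v' (symmDiff γ {z}) := by
  classical
  intro x hx
  have hcard : ∀ γ : Finset Q, {x' | x' ∈ γ ∧ ∃ p, D.b x' p = x}.ncard =
      (γ.filter fun x' => ∃ p, D.b x' p = x).card := by
    intro γ
    rw [← Set.ncard_coe_finset]; congr 1; ext; simp
  have h0 := hγ x hx
  rw [hcard] at h0 ⊢
  have hfilter : (symmDiff γ {z}).filter (fun x' => ∃ p, D.b x' p = x) =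
      symmDiff (γ.filter fun x' => ∃ p, D.b x' p = x)
        (({z} : Finset Q).filter fun x' => ∃ p, D.b x' p = x) := by
    ext x'
    simp only [Finset.mem_filter, Finset.mem_symmDiff]
    tauto
  rw [hfilter, Finset.filter_singleton]
  by_cases hzx : ∃ p, D.b z p = x
  · rw [if_pos hzx, odd_card_symmDiff_singleton, h0]
    rcases (hz x).1 hzx with rfl | rfl
    · simp [hne]
    · simp [hne.symm]
  · rw [if_neg hzx, ← Finset.bot_eq_empty, symmDiff_bot, h0]
    rw [hz, not_or] at hzx
    simp [hzx.1, hzx.2]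

/-- The empty line works for a vertex of the free arc. It is transported along a walk in
`blackGraph`: an edge coming from a quad toggles that quad, and a step between free vertices changes
nothing, as parity is only prescribed off the free arc. -/
theorem exists_isDisorderLine [Fintype B] [Fintype W] [Fintype Q] [DecidableEq Q]
    {D : DomainData B W Q n m} (hD : D.IsDobrushinDomain) (v : B) :
    ∃ γ, D.IsDisorderLine v γ := by
  have hadj : ∀ a b : B, D.blackGraph.Adj a b → (∃ γ, D.IsDisorderLine a γ) →
      ∃ γ, D.IsDisorderLine b γ := by
    rintro a b hab ⟨γ, hγ⟩
    have free : a ∈ Set.range D.free → b ∈ Set.range D.free → ∃ γ, D.IsDisorderLine b γ := by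
      intro ha hb
      refine ⟨γ, fun v' hv' => ?_⟩
      rw [hγ v' hv']
      exact iff_of_false (fun h => hv' (h ▸ ha)) (fun h => hv' (h ▸ hb))
    rw [blackGraph, SimpleGraph.fromRel_adj] at hab
    rcases hab.2 with (⟨z, hz⟩ | h) | (⟨z, hz⟩ | h)
    · refine ⟨_, hγ.symmDiff_singleton (z := z) hab.1 fun x => ?_⟩
      rw [Fin.exists_fin_two, hz.1, hz.2, eq_comm, eq_comm (a := b)]
    · exact free h.1 h.2
    · refine ⟨_, hγ.symmDiff_singleton (z := z) hab.1 fun x => ?_⟩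
      rw [Fin.exists_fin_two, hz.1, hz.2, eq_comm, eq_comm (a := a), or_comm]
    · exact free h.2 h.1
  have hwalk : ∀ a b : B, D.blackGraph.Walk a b → (∃ γ, D.IsDisorderLine b γ) →
      ∃ γ, D.IsDisorderLine a γ := by
    intro a b w hb
    induction w with
    | nil => exact hb
    | cons h _ ih => exact hadj _ _ h.symm (ih hb)
  obtain ⟨w⟩ := hD.connected.preconnected v (D.free 0)
  refine hwalk _ _ w ⟨∅, fun v' hv' => iff_of_false ?_ ?_⟩
  · simp
  · rintro rfl
    exact hv' ⟨0, rfl⟩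

theorem spin_mul_self (σ : W → ℤˣ) (y : W) : spin σ y * spin σ y = 1 := by
  rcases Int.units_eq_one_or (σ y) with h | h <;> simp [spin, h]

theorem fkObservable_wired [Fintype W] [Fintype Q] (D : DomainData B W Q n m) (i : Fin (n + 1))
    (γ : Finset Q) : D.fkObservable (D.wired i) γ = D.fkObservable (D.wired 0) γ := by
  unfold fkObservable expect
  congr 1
  refine Finset.sum_congr rfl fun σ hσ => ?_
  have : σ (D.wired i) = σ (D.wired 0) := (Finset.mem_filter.1 hσ).2 i
  simp only [spin, this]

/-- The product of two wired spins is `1`, which leaves an average of exponentials. All sign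
information on `F` originates here. -/
theorem fkObservable_wired_pos [Fintype W] [Fintype Q] (D : DomainData B W Q n m)
    (i : Fin (n + 1)) (γ : Finset Q) : 0 < D.fkObservable (D.wired i) γ := by
  rw [fkObservable_wired]
  have hne : D.configs.Nonempty := ⟨fun _ => 1, by simp [configs]⟩
  refine div_pos (Finset.sum_pos (fun σ _ => ?_) hne)
    (Finset.sum_pos (fun σ _ => Real.exp_pos _) hne)
  simp only [spin_mul_self, one_mul]
  exact mul_pos (Real.exp_pos _) (Finset.prod_pos fun _ _ => Real.exp_pos _)

theorem mul_pos_trans {a b c : ℝ} (hab : 0 < a * b) (hbc : 0 < b * c) : 0 < a * c := by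
  have hb : 0 < b * b := mul_self_pos.2 (right_ne_zero_of_mul hab.ne')
  refine (pos_iff_pos_of_mul_pos (lt_of_lt_of_eq (mul_pos hab hbc) ?_)).1 hb
  ring

/-! ### The sign of the s-holomorphic function around a vertex of the layer -/

/-- If the spinors have the sign `s` at two upward corners of a face lying in the same quadrant,
then the corner values have the same sign. -/
theorem cornerValue_mul_pos_of_same_quadrant {E : EmbeddingData B W Q n m} (F : Face Q n m → ℂ) {f : Face Q n m}
    {p q p' q' : Fin 2} {v v' : B} {y y' : W} (h : E.black v - E.white y = E.X f p q ^ 2)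
    (h' : E.black v' - E.white y' = E.X f p' q' ^ 2) (him : (E.white y).im < (E.black v).im)
    (him' : (E.white y').im < (E.black v').im)
    (hs : (0 < (E.X f p q * E.X f p' q').im ∧
        0 < spinorOf E F f p q * spinorOf E F f p' q') ∨
      ((E.X f p q * E.X f p' q').im < 0 ∧ spinorOf E F f p q * spinorOf E F f p' q' < 0)) :
    0 < cornerValue E F f v y * cornerValue E F f v' y' := by
  obtain ⟨σ, hσ, hre, him, hn, e⟩ := exists_sign_spinorOf F h him
  obtain ⟨τ, hτ, hre', him', hn', e'⟩ := exists_sign_spinorOf F h' him'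
  have hprod : 0 < (σ * spinorOf E F f p q) * (τ * spinorOf E F f p' q') := by
    have hσ2 : σ * σ = 1 := by rcases hσ with rfl | rfl <;> norm_num
    rcases hs with ⟨hX, hsp⟩ | ⟨hX, hsp⟩
    · obtain rfl := sign_eq_of_im_mul_pos hσ hτ hre him hre' him' hX
      calc (0 : ℝ) < _ := hsp
        _ = (σ * σ) * (spinorOf E F f p q * spinorOf E F f p' q') := by rw [hσ2, one_mul]
        _ = _ := by ring
    · have hτσ : τ = -σ := by rw [sign_eq_neg_of_im_mul_neg hσ hτ hre him hre' him' hX, neg_neg]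
      calc (0 : ℝ) < -(spinorOf E F f p q * spinorOf E F f p' q') := by linarith
        _ = (σ * σ) * -(spinorOf E F f p q * spinorOf E F f p' q') := by rw [hσ2, one_mul]
        _ = _ := by rw [hτσ]; ring
  rw [e, e', mul_mul_mul_comm] at hprod
  exact (pos_iff_pos_of_mul_pos hprod).1 (by positivity)

theorem cornerValue_ne_zero {E : EmbeddingData B W Q n m} {F : Face Q n m → ℂ} {f : Face Q n m}
    {p q : Fin 2} {v : B} {y : W} (h : E.black v - E.white y = E.X f p q ^ 2)
    (him : (E.white y).im < (E.black v).im) (hs : spinorOf E F f p q ≠ 0) :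
    cornerValue E F f v y ≠ 0 := by
  obtain ⟨σ, hσ, -, -, -, e⟩ := exists_sign_spinorOf F h him
  intro h0
  rw [h0, mul_zero] at e
  rcases hσ with rfl | rfl <;> simp_all

/-- The corner values of `F` at a vertex of the layer have the same sign at both corners of a
face. -/
theorem cornerValue_mul_pos_of_pair {E : EmbeddingData B W Q n m} {F : Face Q n m → ℂ}
    {f : Face Q n m} {q : Fin 2} {v : Fin 2 → B} {y : W}
    (hsq : ∀ p, E.black (v p) - E.white y = E.X f p q ^ 2)
    (him : ∀ p, (E.white y).im < (E.black (v p)).im)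
    (hs : (0 < (E.X f 0 q * E.X f 1 q).im ∧ 0 < spinorOf E F f 0 q * spinorOf E F f 1 q) ∨
      ((E.X f 0 q * E.X f 1 q).im < 0 ∧ spinorOf E F f 0 q * spinorOf E F f 1 q < 0))
    (p p' : Fin 2) : 0 < cornerValue E F f (v p) y * cornerValue E F f (v p') y := by
  have h01 := cornerValue_mul_pos_of_same_quadrant F (hsq 0) (hsq 1) (him 0) (him 1) hs
  have h0 := left_ne_zero_of_mul h01.ne'
  have h1 := right_ne_zero_of_mul h01.ne'
  fin_cases p <;> fin_cases p'
  · exact mul_self_pos.2 h0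
  · exact h01
  · exact mul_comm (cornerValue E F f (v 1) y) _ ▸ h01
  · exact mul_self_pos.2 h1

/-- In a face above a horizontal line through its white vertex `w₀`, the spinor values at the two
corners at this vertex lie in the same quadrant. -/
theorem IsSEmbedding.im_mul_pos {D : DomainData B W Q n m} {E : EmbeddingData B W Q n m}
    (hE : D.IsSEmbedding E) (f : Face Q n m)
    (hb : ∀ p, (D.wpos E f 0).im < (D.bpos E f p).im)
    (hw : (D.wpos E f 0).im ≤ (D.wpos E f 1).im) : 0 < (E.X f 0 0 * E.X f 1 0).im := by
  have hθ := hE.θ_mem f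
  refine im_mul_pos_of_upper (Real.sin_pos_of_pos_of_lt_pi hθ.1 (by linarith [hθ.2, Real.pi_pos]))
    (Real.sin_sq_add_cos_sq (E.θ f)) ?_ ?_ (hE.threeTerm f).1 ?_
  · rw [← hE.sq, sub_im]; linarith [hb 0]
  · rw [← hE.sq, sub_im]; linarith [hb 1]
  · rw [← hE.sq, ← hE.sq, sub_im, sub_im]; linarith

/-- At the white vertex of index `1` the neighbour of `c₀₁` is the other lift of `c₁₁`, so the upper
criterion applies to `-X 1 1`. -/
theorem IsSEmbedding.im_mul_neg {D : DomainData B W Q n m} {E : EmbeddingData B W Q n m}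
    (hE : D.IsSEmbedding E) (f : Face Q n m)
    (hb : ∀ p, (D.wpos E f 1).im < (D.bpos E f p).im)
    (hw : (D.wpos E f 1).im ≤ (D.wpos E f 0).im) : (E.X f 0 1 * E.X f 1 1).im < 0 := by
  have hθ := hE.θ_mem f
  have := im_mul_pos_of_upper (X := E.X f 0 1) (Y := -E.X f 1 1) (Z := E.X f 0 0)
    (Real.sin_pos_of_pos_of_lt_pi hθ.1 (by linarith [hθ.2, Real.pi_pos]))
    (Real.sin_sq_add_cos_sq (E.θ f)) ?_ ?_ (by rw [(hE.threeTerm f).2.2.1]; ring) ?_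
  · rw [mul_neg, neg_im] at this; linarith
  · rw [← hE.sq, sub_im]; linarith [hb 0]
  · rw [neg_sq, ← hE.sq, sub_im]; linarith [hb 1]
  · rw [← hE.sq, ← hE.sq, sub_im, sub_im]; linarith

/-- At the two corners of a boundary half-quad the spinor takes the same value, which is the FK
observable up to sign. -/
theorem IsFKFunction.spinorOf_wiredFace [Fintype W] [Fintype Q] [DecidableEq Q]
    {D : DomainData B W Q n m} {E : EmbeddingData B W Q n m} {F : Face Q n m → ℂ}
    (hF : D.IsFKFunction E F) {k : Fin n} {γ : Finset Q} (hγ : D.IsDisorderLine (D.apex k) γ) :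
    spinorOf E F (wiredFace k) 0 1 = spinorOf E F (wiredFace k) 0 0 ∧
      |spinorOf E F (wiredFace k) 0 0| = D.fkObservable (D.wired 0) γ := by
  obtain ⟨s, hs, h1, h2⟩ := hF.wiredHalf k γ hγ
  have hpos := fkObservable_wired_pos D 0 γ
  rw [fkObservable_wired] at h1 h2
  rcases hs with rfl | rfl
  · rw [one_mul] at h1 h2
    exact ⟨by rw [← h1, ← h2], by rw [← h1, abs_of_pos hpos]⟩
  · refine ⟨by linarith, ?_⟩
    rw [show spinorOf E F (wiredFace k) 0 0 = -D.fkObservable (D.wired 0) γ by linarith, abs_neg,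
      abs_of_pos hpos]

section

variable [Fintype B] [Fintype W] [Fintype Q] [DecidableEq Q] {D : DomainData B W Q n m}
  {E : EmbeddingData B W Q n m} {F : Face Q n m → ℂ} {k₀ k₁ : ℕ}

/-- The sign of `Im(𝒳𝒳')` and that of the product of the spinor values agree in every type of face;
branching of the double cover affects both in the same way. -/
theorem cornerValue_mul_pos_of_face (hD : D.IsDobrushinDomain) (hE : D.IsSEmbedding E)
    (hF : D.IsFKFunction E F) (hL : D.IsHorizontalLayer E k₀ k₁) {i : Fin (n + 1)} (hi₀ : k₀ < i)
    (hi₁ : i < k₁) {f : Face Q n m} {v v' : B} (hv : D.HasCorner f v (D.wired i))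
    (hv' : D.HasCorner f v' (D.wired i)) :
    0 < cornerValue E F f v (D.wired i) * cornerValue E F f v' (D.wired i) := by
  have hab := hL.above i hi₀ hi₁ f
  match f with
  | Sum.inl z =>
    obtain ⟨⟨p, rfl⟩, ⟨q, hq⟩⟩ := hv
    obtain ⟨⟨p', rfl⟩, -⟩ := hv'
    have him : ∀ p, (E.white (D.wired i)).im < (E.black (D.b z p)).im :=
      fun p => (hab _ ⟨⟨p, rfl⟩, ⟨q, hq⟩⟩).1
    have hw := (hab _ ⟨⟨p, rfl⟩, ⟨q, hq⟩⟩).2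
    have hsq : ∀ p, E.black (D.b z p) - E.white (D.wired i) = E.X (Sum.inl z) p q ^ 2 := by
      intro p
      rw [← hE.sq, ← hq]; rfl
    obtain ⟨γ, hγ⟩ := exists_isDisorderLine hD (D.b z 0)
    obtain ⟨s, hs, hX⟩ := hF.quad z γ hγ
    have hs2 : s * s = 1 := by rcases hs with rfl | rfl <;> norm_num
    have hsp : ∀ q, spinorOf E F (Sum.inl z) 0 q * spinorOf E F (Sum.inl z) 1 q =
        D.quadValue z γ 0 q * D.quadValue z γ 1 q := by
      intro q
      rw [hX, hX, mul_mul_mul_comm, hs2, one_mul]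
    refine cornerValue_mul_pos_of_pair hsq him ?_ p p'
    have hp1 := fkObservable_wired_pos D i γ
    have hp2 := fkObservable_wired_pos D i (symmDiff γ {z})
    rw [hsp]
    fin_cases q
    · have hq : D.w z 0 = D.wired i := hq
      refine Or.inl ⟨hE.im_mul_pos _ ?_ ?_, ?_⟩
      · intro p; simp only [wpos, bpos, hq]; exact him p
      · simpa only [wpos, hq] using hw 1
      · simp only [quadValue, hq]
        exact mul_pos hp1 hp2
    · have hq : D.w z 1 = D.wired i := hq
      refine Or.inr ⟨hE.im_mul_neg _ ?_ ?_, ?_⟩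
      · intro p; simp only [wpos, bpos, hq]; exact him p
      · simpa only [wpos, hq] using hw 0
      -- Whether or not `γ` contains `z`, the two signs in this column multiply to `-1`, matching
      -- the negative imaginary part.
      · simp only [quadValue, hq]
        have := mul_pos hp1 hp2
        by_cases hz : z ∈ γ
        · simpa [hz] using this
        · simpa [hz] using this
  | Sum.inr (Sum.inl k) =>
    -- A wired half-quad has a single corner at this vertex, so only nonvanishing is needed.
    have him := (hab _ hv).1
    obtain ⟨rfl, hk⟩ := hv
    obtain ⟨rfl, -⟩ := hv'
    obtain ⟨γ, hγ⟩ := exists_isDisorderLine hD (D.apex k)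
    obtain ⟨e1, e2⟩ := hF.spinorOf_wiredFace hγ
    have hne : spinorOf E F (wiredFace k) 0 0 ≠ 0 := by
      rw [← abs_pos, e2]; exact fkObservable_wired_pos D 0 γ
    refine mul_self_pos.2 ?_
    rcases hk with hk | hk
    · exact cornerValue_ne_zero (p := 0) (q := 0)
        (by rw [← hE.sq, ← hk]; rfl) him hne
    · exact cornerValue_ne_zero (p := 0) (q := 1)
        (by rw [← hE.sq, ← hk]; rfl) him (e1 ▸ hne)
  | Sum.inr (Sum.inr j) =>
    obtain ⟨hv, hj⟩ := hv
    obtain ⟨hv', -⟩ := hv'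
    set u : Fin 2 → B := ![D.free j.castSucc, D.free j.succ] with hu
    have hcorner : ∀ p, D.HasCorner (freeFace j) (u p) (D.wired i) := by
      intro p; fin_cases p
      exacts [⟨Or.inl rfl, hj⟩, ⟨Or.inr rfl, hj⟩]
    have him : ∀ p, (E.white (D.wired i)).im < (E.black (u p)).im := fun p => (hab _ (hcorner p)).1
    have hw := (hab _ (hcorner 0)).2
    have hsq : ∀ p, E.black (u p) - E.white (D.wired i) = E.X (freeFace j) p 0 ^ 2 := by
      intro p
      rw [← hE.sq, ← hj]; fin_cases p <;> rfl
    have hpair := cornerValue_mul_pos_of_pair (F := F) hsq him (Or.inl ⟨?_, ?_⟩)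
    · obtain ⟨p, rfl⟩ : ∃ p, u p = v := by
        rcases hv with rfl | rfl
        exacts [⟨0, rfl⟩, ⟨1, rfl⟩]
      obtain ⟨p', rfl⟩ : ∃ p, u p = v' := by
        rcases hv' with rfl | rfl
        exacts [⟨0, rfl⟩, ⟨1, rfl⟩]
      exact hpair p p'
    · have hw0 : D.wpos E (freeFace j) 0 = E.white (D.wired i) := by rw [← hj]; rfl
      refine hE.im_mul_pos _ (fun p => ?_) ?_
      · rw [hw0]
        have := him p
        fin_cases p <;> exact this
      · rw [hw0]; exact hw 1
    · obtain ⟨γ, hγ⟩ := exists_isDisorderLine hD (D.free j.castSucc)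
      obtain ⟨s, hs, h1, h2⟩ := hF.freeHalf j γ hγ
      have hs2 : s * s = 1 := by rcases hs with rfl | rfl <;> norm_num
      have hpos := fkObservable_wired_pos D i γ
      rw [hj] at h1 h2
      have : spinorOf E F (freeFace j) 0 0 * spinorOf E F (freeFace j) 1 0 =
          D.fkObservable (D.wired i) γ * D.fkObservable (D.wired i) γ := by
        nth_rewrite 1 [h1]
        rw [h2, mul_mul_mul_comm, hs2, one_mul]
      rw [this]
      exact mul_pos hpos hpos

/-- All corner values of `F` at an inner vertex of the layer have the same sign. -/
theorem cornerValue_mul_pos (hD : D.IsDobrushinDomain) (hE : D.IsSEmbedding E)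
    (hF : D.IsFKFunction E F) (hL : D.IsHorizontalLayer E k₀ k₁) {i : Fin (n + 1)} (hi₀ : k₀ < i)
    (hi₁ : i < k₁) {f g : Face Q n m} {v v' : B} (hv : D.HasCorner f v (D.wired i))
    (hv' : D.HasCorner g v' (D.wired i)) :
    0 < cornerValue E F f v (D.wired i) * cornerValue E F g v' (D.wired i) := by
  have hfan := hD.white_fan (D.wired i) f g ⟨v, hv⟩ ⟨v', hv'⟩
  induction hfan generalizing v' with
  | refl => exact cornerValue_mul_pos_of_face hD hE hF hL hi₀ hi₁ hv hv'
  | tail _ hstep ih =>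
    -- Consecutive faces of the fan share the corner at `x`, where their corner values coincide.
    obtain ⟨x, h1, h2⟩ := hstep
    have hx := ih h1
    rw [hF.sHolomorphic.cornerValue_eq h1 h2] at hx
    have hy := cornerValue_mul_pos_of_face hD hE hF hL hi₀ hi₁ h2 hv'
    exact mul_pos_trans hx hy

/-- The two corner values of `F` at a half-quad of the layer have the same sign. -/
theorem cornerValue_wiredFace_mul_pos (hD : D.IsDobrushinDomain) (hE : D.IsSEmbedding E)
    (hF : D.IsFKFunction E F) (hL : D.IsHorizontalLayer E k₀ k₁) {k : Fin n} (hk₀ : k₀ ≤ k)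
    (hk₁ : k < k₁) :
    0 < (E.X (wiredFace k) 0 0 * E.X (wiredFace k) 0 1).im ∧
    0 < cornerValue E F (wiredFace k) (D.apex k) (D.wired k.castSucc) *
      cornerValue E F (wiredFace k) (D.apex k) (D.wired k.succ) := by
  have h1 := hL.im_eq k hk₀ hk₁
  have h2 := hL.im_apex k hk₀ hk₁
  have h3 := hL.im_missing k hk₀ hk₁
  have e00 : E.black (D.apex k) - E.white (D.wired k.castSucc) = E.X (wiredFace k) 0 0 ^ 2 :=
    hE.sq (wiredFace k) 0 0
  have e01 : E.black (D.apex k) - E.white (D.wired k.succ) = E.X (wiredFace k) 0 1 ^ 2 :=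
    hE.sq (wiredFace k) 0 1
  have e10 : E.missing (Sum.inl k) - E.white (D.wired k.castSucc) = E.X (wiredFace k) 1 0 ^ 2 :=
    hE.sq (wiredFace k) 1 0
  have hθ := hE.θ_mem (wiredFace k)
  have him : 0 < (E.X (wiredFace k) 0 0 * E.X (wiredFace k) 0 1).im := by
    refine im_mul_pos_of_lower
      (Real.cos_pos_of_mem_Ioo ⟨by linarith [hθ.1, Real.pi_pos], hθ.2⟩) ?_ ?_
      (hE.threeTerm (wiredFace k)).1 ?_
    · rw [← e00, sub_im]; linarith
    · rw [← e01, sub_im]; linarith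
    · rw [← e10, sub_im]; linarith
  refine ⟨him, cornerValue_mul_pos_of_same_quadrant F e00 e01 h2 (by linarith) (Or.inl ⟨him, ?_⟩)⟩
  obtain ⟨γ, hγ⟩ := exists_isDisorderLine hD (D.apex k)
  obtain ⟨e1, e2⟩ := hF.spinorOf_wiredFace hγ
  rw [e1]
  refine mul_self_pos.2 ?_
  rw [← abs_pos, e2]; exact fkObservable_wired_pos D 0 γ

/-- For a suitable global sign, all corner values of `F` along the layer are positive. -/
theorem exists_sign_layer (hD : D.IsDobrushinDomain) (hE : D.IsSEmbedding E)
    (hF : D.IsFKFunction E F) (hL : D.IsHorizontalLayer E k₀ k₁) :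
    ∃ s : ℝ, (s = 1 ∨ s = -1) ∧ ∀ k : Fin n, k₀ ≤ k → k < k₁ →
      0 < s * cornerValue E F (wiredFace k) (D.apex k) (D.wired k.castSucc) := by
  set val : Fin n → ℝ := fun k => cornerValue E F (wiredFace k) (D.apex k) (D.wired k.castSucc)
  -- Cross the half-quad `k` to its right corner, then turn around the white vertex it shares with
  -- `k'`. The bounds make this vertex interior to the layer.
  have hstep : ∀ k k' : Fin n, k₀ ≤ k → (k' : ℕ) = k + 1 → k' < k₁ → 0 < val k * val k' := by
    intro k k' hk hkk hk'
    have h1 := (cornerValue_wiredFace_mul_pos hD hE hF hL hk (by omega)).2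
    have hi : k.succ = k'.castSucc := by ext; simp [hkk]
    rw [hi] at h1
    have h2 := cornerValue_mul_pos hD hE hF hL (i := k'.castSucc) (f := wiredFace k)
      (g := wiredFace k') (v := D.apex k) (v' := D.apex k') (by simp; omega) (by simpa using hk')
      ⟨rfl, Or.inr (by rw [hi])⟩ ⟨rfl, Or.inl rfl⟩
    exact mul_pos_trans h1 h2
  by_cases hne : ∃ h : k₀ < n, k₀ < k₁
  · obtain ⟨hn, hk⟩ := hne
    have h0 : val ⟨k₀, hn⟩ ≠ 0 :=
      left_ne_zero_of_mul (cornerValue_wiredFace_mul_pos hD hE hF hL (k := ⟨k₀, hn⟩) le_rfl hk).2.ne'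
    obtain ⟨s, hs, hs0⟩ : ∃ s : ℝ, (s = 1 ∨ s = -1) ∧ 0 < s * val ⟨k₀, hn⟩ := by
      rcases h0.lt_or_gt with h | h
      exacts [⟨-1, Or.inr rfl, by linarith⟩, ⟨1, Or.inl rfl, by linarith⟩]
    refine ⟨s, hs, ?_⟩
    have key : ∀ j (hj : j < n), k₀ ≤ j → j < k₁ → 0 < s * val ⟨j, hj⟩ := by
      intro j hj hkj
      induction j, hkj using Nat.le_induction with
      | base => intro _; exact hs0
      | succ j hkj ih =>
        intro hj1
        have h1 := ih (by omega) (by omega)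
        have h2 := hstep ⟨j, by omega⟩ ⟨j + 1, hj⟩ hkj rfl hj1
        rcases hs with rfl | rfl <;> nlinarith
    exact fun k hk hk' => key k k.2 hk hk'
  · exact ⟨1, Or.inl rfl, fun k hk hk' => absurd ⟨lt_of_le_of_lt hk k.2, lt_of_le_of_lt hk hk'⟩ hne⟩

end

/-! ### Estimates in a single half-quad -/

theorem varsigma_mul_conj : varsigma * starRingEnd ℂ varsigma = 1 := by
  rw [mul_conj, varsigma, normSq_eq_norm_sq, norm_exp]
  simp

theorem I_mul_conj_varsigma : I * starRingEnd ℂ varsigma = varsigma := by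
  have h : varsigma * varsigma = I := by
    rw [varsigma, ← exp_add]
    nth_rewrite 3 [← exp_pi_div_two_mul_I]
    congr 1; ring
  rw [← h, mul_assoc, varsigma_mul_conj, mul_one]

theorem exp_mul_varsigma (φ : ℝ) :
    exp (φ * I) * varsigma = ⟨Real.cos (φ + Real.pi / 4), Real.sin (φ + Real.pi / 4)⟩ := by
  rw [varsigma, ← exp_add]
  have : (φ : ℂ) * I + Real.pi / 4 * I = ((φ + Real.pi / 4 : ℝ) : ℂ) * I := by push_cast; ring
  rw [this]
  apply Complex.ext
  · rw [exp_ofReal_mul_I_re]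
  · rw [exp_ofReal_mul_I_im]

/-- Uniform bounds in a half-quad with sides `(p₁ + i p₂) ^ 2` and `(q₁ + i q₂) ^ 2`. -/
theorem half_quad_ratio_bounds {r κ p₁ p₂ q₁ q₂ : ℝ} (hr : 1 ≤ r) (hκ : 0 < κ) (hκ₁ : κ ≤ 1)
    (hp₂ : 0 < p₂) (hq₁ : 0 < q₁) (hqp : q₁ < p₁) (hpq : p₂ < q₂) (hh : p₁ * p₂ = q₁ * q₂)
    (hp : r⁻¹ ≤ p₁ ^ 2 + p₂ ^ 2) (hp' : p₁ ^ 2 + p₂ ^ 2 ≤ r)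
    (hq : r⁻¹ ≤ q₁ ^ 2 + q₂ ^ 2) (hq' : q₁ ^ 2 + q₂ ^ 2 ≤ r)
    (hangle : κ * ((p₁ ^ 2 + p₂ ^ 2) * (q₁ ^ 2 + q₂ ^ 2)) ≤ 2 * (p₁ * q₂ - p₂ * q₁) ^ 2) :
    κ / (2 * r ^ 2) ≤ (p₁ - q₁) + (q₂ - p₂) ∧
      κ / (2 * r ^ 3) * q₁ ≤ p₂ ∧ κ / (2 * r ^ 3) * p₂ ≤ q₁ ∧
      κ / (2 * r ^ 3) * (q₂ - p₂) ≤ p₁ - q₁ ∧ κ / (2 * r ^ 3) * (p₁ - q₁) ≤ q₂ - p₂ := by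
  have hr0 : 0 < r := by linarith
  have hp₁ : 0 < p₁ := by linarith
  have hq₂ : 0 < q₂ := by linarith
  have hp₁r : p₁ ≤ r := by nlinarith
  have hq₂r : q₂ ≤ r := by nlinarith
  have hp₂r : p₂ ≤ r := by linarith
  -- The angle hypothesis bounds the squared cross product below by `κ/(2r²)`, which exceeds
  -- `(κ/(2r))²` because `κ ≤ 1`.
  have hδ : κ / (2 * r) ≤ p₁ * q₂ - p₂ * q₁ := by
    have h0 : 0 < p₁ * q₂ - p₂ * q₁ :=
      sub_pos.2 (by rw [mul_comm p₂]; exact mul_lt_mul'' hqp hpq hq₁.le hp₂.le)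
    refine abs_le_of_sq_le_sq' ?_ h0.le |>.2
    have h1 : r⁻¹ * r⁻¹ ≤ (p₁ ^ 2 + p₂ ^ 2) * (q₁ ^ 2 + q₂ ^ 2) :=
      mul_le_mul hp hq (by positivity) (by positivity)
    have h2 : κ * (r⁻¹ * r⁻¹) ≤ κ * ((p₁ ^ 2 + p₂ ^ 2) * (q₁ ^ 2 + q₂ ^ 2)) :=
      mul_le_mul_of_nonneg_left h1 hκ.le
    have h3 : (κ / (2 * r)) ^ 2 = κ * (κ * (r⁻¹ * r⁻¹)) / 4 := by field_simp; norm_num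
    have h4 : κ * (κ * (r⁻¹ * r⁻¹)) ≤ 1 * (κ * (r⁻¹ * r⁻¹)) :=
      mul_le_mul_of_nonneg_right hκ₁ (by positivity)
    have h5 : 0 < κ * (r⁻¹ * r⁻¹) := by positivity
    rw [h3]
    linarith
  obtain ⟨μ, hμdef⟩ : ∃ μ, μ = κ / (2 * r ^ 3) := ⟨_, rfl⟩
  have hμ0 : 0 < μ := by rw [hμdef]; positivity
  have hδμ : κ / (2 * r) = μ * r * r := by rw [hμdef]; field_simp
  have hsμ : κ / (2 * r ^ 2) = μ * r := by rw [hμdef]; field_simp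
  rw [hδμ] at hδ
  rw [← hμdef, hsμ]
  have hprod : μ * r * r ≤ p₁ * q₂ := by linarith [mul_pos hp₂ hq₁]
  have hμ₁ : μ * p₁ ≤ q₂ := by
    refine le_of_mul_le_mul_right ?_ hr0
    linarith [mul_le_mul_of_nonneg_right hp₁r hq₂.le,
      mul_le_mul_of_nonneg_left hp₁r (mul_pos hμ0 hr0).le]
  have hμ₂ : μ * q₂ ≤ p₁ := by
    refine le_of_mul_le_mul_right ?_ hr0
    linarith [mul_le_mul_of_nonneg_left hq₂r hp₁.le,
      mul_le_mul_of_nonneg_left hq₂r (mul_pos hμ0 hr0).le]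
  have hμ₃ : μ * q₁ ≤ p₂ := by
    refine le_of_mul_le_mul_right ?_ hp₁
    linarith [mul_le_mul_of_nonneg_right hμ₁ hq₁.le]
  have hμ₄ : μ * p₂ ≤ q₁ := by
    refine le_of_mul_le_mul_right ?_ hp₁
    calc μ * p₂ * p₁ = μ * q₂ * q₁ := by linear_combination μ * hh
      _ ≤ p₁ * q₁ := mul_le_mul_of_nonneg_right hμ₂ hq₁.le
      _ = q₁ * p₁ := mul_comm _ _
  -- The ratio of the differences equals `p₂/q₁`, so the bounds already found for `p₂` and `q₁`
  -- carry over.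
  have huv : (q₂ - p₂) * q₁ = p₂ * (p₁ - q₁) := by linarith
  have hu : 0 ≤ p₁ - q₁ := by linarith
  have hv : 0 ≤ q₂ - p₂ := by linarith
  refine ⟨?_, hμ₃, hμ₄, ?_, ?_⟩
  -- The cross product is `p₁(q₂ - p₂) + p₂(p₁ - q₁)`, with `p₁, p₂ ≤ r`.
  · refine le_of_mul_le_mul_right ?_ hr0
    linarith [mul_le_mul_of_nonneg_left hp₁r hv, mul_le_mul_of_nonneg_left hp₂r hu]
  · refine le_of_mul_le_mul_right ?_ hq₁
    calc μ * (q₂ - p₂) * q₁ = μ * p₂ * (p₁ - q₁) := by linear_combination μ * huv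
      _ ≤ q₁ * (p₁ - q₁) := mul_le_mul_of_nonneg_right hμ₄ hu
      _ = (p₁ - q₁) * q₁ := mul_comm _ _
  · refine le_of_mul_le_mul_right ?_ hq₁
    calc μ * (p₁ - q₁) * q₁ = μ * q₁ * (p₁ - q₁) := by ring
      _ ≤ p₂ * (p₁ - q₁) := mul_le_mul_of_nonneg_right hμ₃ hu
      _ = (q₂ - p₂) * q₁ := huv.symm

/-- The estimates for the value `Φ` at a half-quad with sides `p ^ 2` and `q ^ 2` issued from its
apex, in terms of the common value `x` of `Re[ς̄ p Φ]` and `Re[ς̄ q Φ]`. -/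
theorem re_increment_bounds {r κ φ x : ℝ} {p q Φ : ℂ} (hr : 1 ≤ r) (hκ : 0 < κ) (hκ₁ : κ ≤ 1)
    (hp₁ : 0 < p.re) (hp₂ : 0 < p.im) (hq₁ : 0 < q.re) (hq₂ : 0 < q.im)
    (him : (p ^ 2).im = (q ^ 2).im) (hre : (q ^ 2).re < (p ^ 2).re)
    (hp : r⁻¹ ≤ ‖p ^ 2‖) (hp' : ‖p ^ 2‖ ≤ r) (hq : r⁻¹ ≤ ‖q ^ 2‖) (hq' : ‖q ^ 2‖ ≤ r)
    (hangle : κ * (‖p ^ 2‖ * ‖q ^ 2‖) ≤ 2 * (p.re * q.im - p.im * q.re) ^ 2)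
    (hx : 0 < x) (hpx : (starRingEnd ℂ varsigma * p * Φ).re = x)
    (hqx : (starRingEnd ℂ varsigma * q * Φ).re = x)
    (hφ : |φ| ≤ Real.pi / 4 + κ / (16 * r ^ 3)) :
    0 ≤ (Φ * exp (φ * I)).re ∧
      (16 * r ^ 5 / κ ^ 2)⁻¹ * x ≤ (exp (φ * I) * (Φ * (p ^ 2 - q ^ 2) +
        I * starRingEnd ℂ Φ * ((‖p ^ 2‖ - ‖q ^ 2‖ : ℝ) : ℂ))).re ∧
      (exp (φ * I) * (Φ * (p ^ 2 - q ^ 2) +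
        I * starRingEnd ℂ Φ * ((‖p ^ 2‖ - ‖q ^ 2‖ : ℝ) : ℂ))).re ≤ 16 * r ^ 5 / κ ^ 2 * x := by
  have hr0 : 0 < r := by linarith
  obtain ⟨G, hG⟩ : ∃ G, G = starRingEnd ℂ varsigma * Φ := ⟨_, rfl⟩
  have hΦ : Φ = varsigma * G := by rw [hG, ← mul_assoc, varsigma_mul_conj, one_mul]
  have hΦ' : I * starRingEnd ℂ Φ = varsigma * starRingEnd ℂ G := by
    rw [hΦ, map_mul, ← mul_assoc, I_mul_conj_varsigma]
  obtain ⟨p₁, p₂⟩ := p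
  obtain ⟨q₁, q₂⟩ := q
  have hnorm : ∀ a b : ℝ, ‖(⟨a, b⟩ : ℂ) ^ 2‖ = a ^ 2 + b ^ 2 := by
    intro a b
    rw [norm_pow, ← normSq_eq_norm_sq, normSq_mk]; ring
  have hsqre : ∀ a b : ℝ, ((⟨a, b⟩ : ℂ) ^ 2).re = a ^ 2 - b ^ 2 := by
    intro a b; rw [sq, mul_re]; ring
  have hsqim : ∀ a b : ℝ, ((⟨a, b⟩ : ℂ) ^ 2).im = 2 * (a * b) := by
    intro a b; rw [sq, mul_im]; ring
  simp only [hnorm] at hp hp' hq hq' hangle ⊢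
  rw [hsqre, hsqre] at hre
  rw [hsqim, hsqim] at him
  dsimp only at hp₁ hp₂ hq₁ hq₂ hangle
  have hpx' : G.re * p₁ + (-G.im) * p₂ = x := by
    rw [← hpx, mul_right_comm, ← hG, mul_re]; ring
  have hqx' : G.re * q₁ + (-G.im) * q₂ = x := by
    rw [← hqx, mul_right_comm, ← hG, mul_re]; ring
  obtain ⟨hqp, hpq, t, ht, hg₁, hg₂, hxt⟩ :=
    linear_form_of_eq hp₁ hp₂ hq₁ hq₂ (by linarith) hre hx hpx' hqx'
  have hG₂ : G.im = -(t * q₁) := by linarith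
  have hp₁r : p₁ ≤ r := by nlinarith
  have hq₂r : q₂ ≤ r := by nlinarith
  have hh : p₁ * p₂ = q₁ * q₂ := by linarith
  obtain ⟨hsum, hμ₃, hμ₄, hμ₅, hμ₆⟩ :=
    half_quad_ratio_bounds hr hκ hκ₁ hp₂ hq₁ hqp hpq hh hp hp' hq hq' hangle
  obtain ⟨μ, hμdef⟩ : ∃ μ, μ = κ / (2 * r ^ 3) := ⟨_, rfl⟩
  have hμ0 : 0 < μ := by rw [hμdef]; positivity
  rw [← hμdef] at hμ₃ hμ₄ hμ₅ hμ₆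
  have hφ₀ : κ / (16 * r ^ 3) = μ / 8 := by
    rw [hμdef]; field_simp; norm_num
  rw [hφ₀] at hφ
  have hφ1 := (abs_le.1 hφ).1
  have hφ2 := (abs_le.1 hφ).2
  have bound : ∀ u v : ℝ, 0 < u → 0 < v → μ * v ≤ u → μ * u ≤ v →
      μ * (u + v) / 4 ≤ u * Real.cos (φ + Real.pi / 4) + v * Real.sin (φ + Real.pi / 4) :=
    fun u v hu hv h h' => mul_cos_add_mul_sin_ge hu hv hμ0 h h' (by positivity) le_rfl
      (by linarith) (by linarith)
  constructor
  · have e : (Φ * exp (φ * I)).re =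
        t * (p₂ * Real.cos (φ + Real.pi / 4) + q₁ * Real.sin (φ + Real.pi / 4)) := by
      rw [hΦ, mul_comm, ← mul_assoc, exp_mul_varsigma, mul_re, hg₁, hG₂]
      ring
    rw [e]
    refine mul_nonneg ht.le (le_trans ?_ (bound p₂ q₁ hp₂ hq₁ hμ₃ hμ₄))
    positivity
  · have hL : (⟨p₁, p₂⟩ : ℂ) ^ 2 - (⟨q₁, q₂⟩ : ℂ) ^ 2 =
        ((p₁ ^ 2 - p₂ ^ 2 - (q₁ ^ 2 - q₂ ^ 2) : ℝ) : ℂ) := by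
      apply Complex.ext
      · rw [sub_re, hsqre, hsqre, ofReal_re]
      · rw [sub_im, hsqim, hsqim, ofReal_im]; linarith
    have e : (exp (φ * I) * (Φ * ((⟨p₁, p₂⟩ : ℂ) ^ 2 - (⟨q₁, q₂⟩ : ℂ) ^ 2) +
        I * starRingEnd ℂ Φ * ((p₁ ^ 2 + p₂ ^ 2 - (q₁ ^ 2 + q₂ ^ 2) : ℝ) : ℂ))).re =
        2 * x * ((p₁ - q₁) * Real.cos (φ + Real.pi / 4) +
          (q₂ - p₂) * Real.sin (φ + Real.pi / 4)) := by
      rw [hL, hΦ', hΦ, mul_assoc, mul_assoc, ← mul_add, ← mul_assoc, exp_mul_varsigma, mul_re,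
        add_re, add_im, re_mul_ofReal, re_mul_ofReal, im_mul_ofReal, im_mul_ofReal, conj_re,
        conj_im, hg₁, hG₂, hxt]
      -- The real part of `G` is multiplied by `d𝒮 + d𝒬 = 2(p₁² - q₁²)` and the imaginary part by
      -- `d𝒮 - d𝒬 = 2(q₂² - p₂²)`. The relation `p₁p₂ = q₁q₂` turns `q₁(q₂ + p₂)` into `p₂(p₁ +
      -- q₁)`, so that `x` factors out of both.
      linear_combination (2 * t * (q₂ - p₂) * Real.sin (φ + Real.pi / 4)) * (-hh)
    rw [e]
    have hu : 0 < p₁ - q₁ := by linarith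
    have hv : 0 < q₂ - p₂ := by linarith
    have hlow := bound _ _ hu hv hμ₅ hμ₆
    constructor
    · have h1 : (16 * r ^ 5 / κ ^ 2)⁻¹ * x = 2 * x * (μ * (κ / (2 * r ^ 2)) / 8) := by
        rw [hμdef]; field_simp; norm_num
      have h3 := mul_le_mul_of_nonneg_left hsum hμ0.le
      have h4 : 0 < μ * (κ / (2 * r ^ 2)) := by positivity
      rw [h1]
      refine mul_le_mul_of_nonneg_left ?_ (by positivity)
      linarith
    · have h1 : (p₁ - q₁) * Real.cos (φ + Real.pi / 4) ≤ p₁ - q₁ :=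
        mul_le_of_le_one_right hu.le (Real.cos_le_one _)
      have h2 : (q₂ - p₂) * Real.sin (φ + Real.pi / 4) ≤ q₂ - p₂ :=
        mul_le_of_le_one_right hv.le (Real.sin_le_one _)
      have h3 : 4 * r ≤ 16 * r ^ 5 / κ ^ 2 := by
        rw [le_div_iff₀ (by positivity)]
        have h5 : r ≤ r ^ 5 := le_self_pow₀ hr (by norm_num)
        have h6 : r * κ ^ 2 ≤ r * 1 :=
          mul_le_mul_of_nonneg_left (pow_le_one₀ hκ.le hκ₁) hr0.le
        linarith
      have h4 : 4 * r * x ≤ 16 * r ^ 5 / κ ^ 2 * x := mul_le_mul_of_nonneg_right h3 hx.le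
      refine le_trans ?_ h4
      calc _ ≤ 2 * x * (2 * r) := mul_le_mul_of_nonneg_left (by linarith) (by positivity)
        _ = 4 * r * x := by ring

/-- The angle of a half-quad at its apex, in terms of square roots of its sides. -/
theorem one_sub_cos_angle_mul {a b c p q : ℂ} (hp : c - a = p ^ 2) (hq : c - b = q ^ 2) :
    (1 - Real.cos (EuclideanGeometry.angle a c b)) * (‖p ^ 2‖ * ‖q ^ 2‖) =
      2 * (p.re * q.im - p.im * q.re) ^ 2 := by
  have ha : a - c = -p ^ 2 := by rw [← hp]; ring
  have hb : b - c = -q ^ 2 := by rw [← hq]; ring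
  have h := InnerProductGeometry.cos_angle_mul_norm_mul_norm (-p ^ 2) (-q ^ 2)
  rw [EuclideanGeometry.angle, vsub_eq_sub, vsub_eq_sub, ha, hb, sub_mul, one_mul]
  rw [norm_neg, norm_neg] at h
  rw [h, norm_pow, norm_pow, ← normSq_eq_norm_sq, ← normSq_eq_norm_sq, normSq_apply, normSq_apply,
    inner_neg_neg, Complex.inner]
  -- This is `|w|² - Re w² = 2(Im w)²` for `w = p̄q`.
  simp only [sq, mul_re, mul_im, conj_re, conj_im]
  ring

end DomainData

/-! ### Choice of constants and conclusion. -/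

theorem mainTheorem9 (r₀ θ₀ : ℝ) (hr₀ : 1 ≤ r₀) (hθ₀ : 0 < θ₀) :
    ∃ φ₀ : ℝ, 0 < φ₀ ∧ ∃ C : ℝ, 0 < C ∧
      ∀ (B W Q : Type) [Fintype B] [Fintype W] [Fintype Q] [DecidableEq Q] (n m : ℕ)
        (D : DomainData B W Q n m) (E : EmbeddingData B W Q n m)
        (𝒬 : B ⊕ W → ℝ) (F : Face Q n m → ℂ) (k₀ k₁ : ℕ),
        D.IsDobrushinDomain → D.IsSEmbedding E → D.IsOrigami E 𝒬 →
        D.IsFKFunction E F → D.IsHorizontalLayer E k₀ k₁ →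
        (∀ k : Fin n, k₀ ≤ k → k < k₁ → D.UnifHalfQuad E r₀ θ₀ k) →
        ∃ s : ℝ, (s = 1 ∨ s = -1) ∧
          ∀ k : Fin n, k₀ ≤ k → k < k₁ → ∀ φ : ℝ, |φ| ≤ Real.pi / 4 + φ₀ →
            0 ≤ (s * F (wiredFace k) * Complex.exp (φ * Complex.I)).re ∧
            ∀ y : W, (y = D.wired k.castSucc ∨ y = D.wired k.succ) →
              ∀ γ : Finset Q, D.IsDisorderLine (D.apex k) γ →
                C⁻¹ * |D.fkObservable y γ| ≤
                    (Complex.exp (φ * Complex.I) *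
                      D.increment E 𝒬 (fun f => s * F f) k).re ∧
                  (Complex.exp (φ * Complex.I) *
                      D.increment E 𝒬 (fun f => s * F f) k).re ≤
                    C * |D.fkObservable y γ| := by
  have hr : 0 < r₀ := by linarith
  -- Truncation at `1 < π/2` keeps `cos θ₁` nonnegative, whence `0 < κ ≤ 1`.
  set θ₁ := min θ₀ 1 with hθ₁
  have hθ₁0 : 0 < θ₁ := lt_min hθ₀ one_pos
  have hθ₁π : θ₁ ≤ 1 := min_le_right _ _
  have hπ := Real.pi_gt_three
  set κ := 1 - Real.cos θ₁ with hκdef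
  have hκ : 0 < κ := by
    have : Real.cos θ₁ < Real.cos 0 :=
      Real.cos_lt_cos_of_nonneg_of_le_pi le_rfl (by linarith) hθ₁0
    rw [Real.cos_zero] at this
    linarith
  have hκ₁ : κ ≤ 1 := by
    have : 0 ≤ Real.cos θ₁ := Real.cos_nonneg_of_neg_pi_div_two_le_of_le (by linarith) (by linarith)
    linarith
  refine ⟨κ / (16 * r₀ ^ 3), by positivity, 16 * r₀ ^ 5 / κ ^ 2, by positivity, ?_⟩
  intro B W Q _ _ _ _ n m D E 𝒬 F k₀ k₁ hD hE hQ hF hL hU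
  obtain ⟨s, hs, hsign⟩ := DomainData.exists_sign_layer hD hE hF hL
  refine ⟨s, hs, fun k hk₀ hk₁ φ hφ => ?_⟩
  obtain ⟨γ₀, hγ₀⟩ := DomainData.exists_isDisorderLine hD (D.apex k)
  have him := (DomainData.cornerValue_wiredFace_mul_pos hD hE hF hL hk₀ hk₁).1
  have hval := hsign k hk₀ hk₁
  have hU := hU k hk₀ hk₁
  have h1 := hL.im_eq k hk₀ hk₁
  have h2 := hL.im_apex k hk₀ hk₁
  have h3 := hL.re_lt k hk₀ hk₁
  have e00 : E.black (D.apex k) - E.white (D.wired k.castSucc) = E.X (wiredFace k) 0 0 ^ 2 :=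
    hE.sq (wiredFace k) 0 0
  have e01 : E.black (D.apex k) - E.white (D.wired k.succ) = E.X (wiredFace k) 0 1 ^ 2 :=
    hE.sq (wiredFace k) 0 1
  obtain ⟨σ, hσ, hre₀, him₀, hn, hsp⟩ := DomainData.exists_sign_spinorOf F e00 h2
  obtain ⟨σ', hσ', hre₁, him₁, -, -⟩ := DomainData.exists_sign_spinorOf F e01 (by linarith)
  -- One sign `σ` moves both values of `𝒳` into the first quadrant; they are the square roots `p`,
  -- `q`.
  obtain rfl := DomainData.sign_eq_of_im_mul_pos hσ hσ' hre₀ him₀ hre₁ him₁ him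
  have hσ2 : (σ : ℂ) ^ 2 = 1 := by rcases hσ with rfl | rfl <;> norm_num
  have hp2 : (σ * E.X (wiredFace k) 0 0) ^ 2 = E.X (wiredFace k) 0 0 ^ 2 := by
    rw [mul_pow, hσ2, one_mul]
  have hq2 : (σ * E.X (wiredFace k) 0 1) ^ 2 = E.X (wiredFace k) 0 1 ^ 2 := by
    rw [mul_pow, hσ2, one_mul]
  rw [← hp2] at e00
  rw [← hq2] at e01
  rw [← re_ofReal_mul] at hre₀ hre₁
  rw [← im_ofReal_mul] at him₀ him₁
  obtain ⟨hspeq, -⟩ := hF.spinorOf_wiredFace hγ₀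
  have hx : 0 < s * (σ * DomainData.spinorOf E F (wiredFace k) 0 0) := by
    rw [hsp, mul_left_comm]
    exact mul_pos hn hval
  have hxval : ∀ γ, D.IsDisorderLine (D.apex k) γ → ∀ y : W,
      (y = D.wired k.castSucc ∨ y = D.wired k.succ) →
      |D.fkObservable y γ| = s * (σ * DomainData.spinorOf E F (wiredFace k) 0 0) := by
    intro γ hγ y hy
    have hfk : D.fkObservable y γ = D.fkObservable (D.wired 0) γ := by
      rcases hy with rfl | rfl <;> exact DomainData.fkObservable_wired D _ γ
    rw [hfk, ← (hF.spinorOf_wiredFace hγ).2, abs_abs, ← abs_of_pos hx]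
    rcases hs with rfl | rfl <;> rcases hσ with rfl | rfl <;> simp
  have hangle := DomainData.one_sub_cos_angle_mul e00 e01
  have hcos : κ ≤ 1 - Real.cos (EuclideanGeometry.angle (E.white (D.wired k.castSucc))
      (E.black (D.apex k)) (E.white (D.wired k.succ))) := by
    have : Real.cos (EuclideanGeometry.angle (E.white (D.wired k.castSucc))
        (E.black (D.apex k)) (E.white (D.wired k.succ))) ≤ Real.cos θ₁ :=
      Real.cos_le_cos_of_nonneg_of_le_pi hθ₁0.le (EuclideanGeometry.angle_le_pi _ _ _)
        ((min_le_left _ _).trans hU.angle_ge)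
    linarith
  have hspinor : ∀ q, (starRingEnd ℂ DomainData.varsigma * (σ * E.X (wiredFace k) 0 q) *
      (s * F (wiredFace k))).re = s * (σ * DomainData.spinorOf E F (wiredFace k) 0 q) := by
    intro q
    rw [DomainData.spinorOf, ← re_ofReal_mul, ← re_ofReal_mul]
    congr 1; ring
  have key := DomainData.re_increment_bounds (p := σ * E.X (wiredFace k) 0 0)
    (q := σ * E.X (wiredFace k) 0 1) (Φ := s * F (wiredFace k)) hr₀ hκ hκ₁ hre₀ him₀ hre₁ him₁
    (by rw [← e00, ← e01, sub_im, sub_im, h1])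
    (by rw [← e00, ← e01, sub_re, sub_re]; linarith)
    (by rw [← e00]; exact hU.left_ge) (by rw [← e00]; exact hU.left_le)
    (by rw [← e01]; exact hU.right_ge) (by rw [← e01]; exact hU.right_le)
    (by rw [← hangle]; exact mul_le_mul_of_nonneg_right hcos (by positivity))
    hx (hspinor 0) (by rw [hspinor 1, hspeq]) hφ
  refine ⟨key.1, fun y hy γ hγ => ?_⟩
  -- The apex cancels in the differences: its position in `d𝒮`, its origami value in `d𝒬`.
  have hinc : D.increment E 𝒬 (fun f => s * F f) k = s * F (wiredFace k) *
      ((σ * E.X (wiredFace k) 0 0) ^ 2 - (σ * E.X (wiredFace k) 0 1) ^ 2) +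
      I * starRingEnd ℂ (s * F (wiredFace k)) *
        ((‖(σ * E.X (wiredFace k) 0 0) ^ 2‖ - ‖(σ * E.X (wiredFace k) 0 1) ^ 2‖ : ℝ) : ℂ) := by
    have q0 := hQ (wiredFace k) (D.apex k) (D.wired k.castSucc) ⟨rfl, Or.inl rfl⟩
    have q1 := hQ (wiredFace k) (D.apex k) (D.wired k.succ) ⟨rfl, Or.inr rfl⟩
    rw [← e00, ← e01, ← q0, ← q1, DomainData.increment]
    push_cast
    ring
  rw [hinc, hxval γ hγ y hy]
  exact key.2
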